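/- Identify $\mathbb{C}^2$ with $\mathbb{R}^4$ via $z_j = x_j + i y_j$ and let $\omega_0 = dx_1\wedge dy_1 + dx_2\wedge dy_2$. A symplectic embedding of an open set $U \subset \mathbb{C}^2$ into $V \subset \mathbb{C}^2$ is a smooth embedding $\varphi\colon U \hookrightarrow \mathbb{C}^2$ with $\varphi(U)\subset V$ and $\varphi^*\omega_0=\omega_0$. For $a, A>0$ let \[ P(\pi,a)=\{(z_1,z_2)\in\mathbb{C}^2 : \pi|z_1|^2<\pi,\ \pi|z_2|^2<a\},\qquad B^4(A)=\{(z_1,z_2)\in\mathbb{C}^2 : \pi|z_1|^2+\pi|z_2|^2<A\}. \] Every $a > 2\pi$ satisfies $2(k^2-k+1) < a/\pi \le 2(k^2+k+1)$ for exactly one integer $k\ge 1$; with this $k$ put \[ s_{PB}(a) = \frac{a-2\pi}{2k}+(k+2)\pi . \] Then for every $a>2\pi$ and every $\epsilon>0$ there is a symplectic embedding of $P(\pi,a)$ into $B^4(s_{PB}(a)+\epsilon)$. -/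

import Mathlib

open scoped Real ContDiff

/-- The standard symplectic form `ω₀ = ∑ᵢ dxᵢ ∧ dyᵢ` on `ℂⁿ = ℝ²ⁿ`, with `zᵢ = xᵢ + i yᵢ`. -/
def stdSymplecticForm {n : ℕ} (v w : Fin n → ℂ) : ℝ :=
  ∑ i, ((v i).re * (w i).im - (v i).im * (w i).re)

/-- `φ`, restricted to the open set `U ⊆ ℂⁿ`, is a symplectic embedding of `U` into `V`:
it is smooth (in the real sense) on `U`, a homeomorphism from `U` onto its image, it satisfies
`φ^* ω₀ = ω₀` on `U`, and `φ(U) ⊆ V`. (It is then an immersion, as `ω₀` is nondegenerate.)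
The values of `φ` outside `U` play no role. -/
structure IsSymplecticEmbedding {n : ℕ} (φ : (Fin n → ℂ) → (Fin n → ℂ))
    (U V : Set (Fin n → ℂ)) : Prop where
  contDiffOn : ContDiffOn ℝ ∞ φ U
  isEmbedding : Topology.IsEmbedding (U.domRestrict φ)
  pullback_eq : ∀ z ∈ U, ∀ v w : Fin n → ℂ,
    stdSymplecticForm (fderiv ℝ φ z v) (fderiv ℝ φ z w) = stdSymplecticForm v w
  mapsTo : Set.MapsTo φ U V

/-- `U` symplectically embeds in `V`. -/
def SymplecticallyEmbeds {n : ℕ} (U V : Set (Fin n → ℂ)) : Prop :=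
  ∃ φ : (Fin n → ℂ) → (Fin n → ℂ), IsSymplecticEmbedding φ U V

/-- The open disc `D(a) ⊆ ℂ` of area `a`, centred at the origin. -/
def openDisc (a : ℝ) : Set ℂ := {z | π * ‖z‖ ^ 2 < a}

/-- The polydisc `P(a₁, …, aₙ) = D(a₁) × ⋯ × D(aₙ)`. -/
def polydisc {n : ℕ} (a : Fin n → ℝ) : Set (Fin n → ℂ) := {z | ∀ i, z i ∈ openDisc (a i)}

/-- The open symplectic ellipsoid `E(a₁, …, aₙ)` with radii `√(aᵢ / π)`. -/
def symplecticEllipsoid {n : ℕ} (a : Fin n → ℝ) : Set (Fin n → ℂ) :=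
  {z | ∑ i, π * ‖z i‖ ^ 2 / a i < 1}

/-- The ball `B²ⁿ(A) = E(A, …, A)`. -/
def symplecticBall (n : ℕ) (A : ℝ) : Set (Fin n → ℂ) := symplecticEllipsoid fun _ => A

/-- The integer `k ≥ 1` satisfies `2(k² - k + 1) < a/π ≤ 2(k² + k + 1)`. -/
def IsFoldIndex (a : ℝ) (k : ℕ) : Prop :=
  1 ≤ k ∧ 2 * ((k : ℝ) ^ 2 - k + 1) < a / π ∧ a / π ≤ 2 * ((k : ℝ) ^ 2 + k + 1)

theorem existsUnique_isFoldIndex {a : ℝ} (ha : 2 * π < a) : ∃! k : ℕ, IsFoldIndex a k := by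
  classical
  have hx : 2 < a / π := by rwa [lt_div_iff₀ Real.pi_pos]
  have hex : ∃ k : ℕ, a / π ≤ 2 * ((k : ℝ) ^ 2 + k + 1) := by
    obtain ⟨k, hk⟩ := exists_nat_ge (a / π)
    exact ⟨k, by nlinarith [sq_nonneg (k : ℝ), (Nat.cast_nonneg k : (0 : ℝ) ≤ k)]⟩
  have huniq : ∀ k m : ℕ, IsFoldIndex a k → IsFoldIndex a m → k ≤ m := by
    rintro k m ⟨-, hk, -⟩ ⟨-, -, hm⟩
    by_contra! h
    have h' : (m : ℝ) + 1 ≤ k := by exact_mod_cast h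
    have hm0 : (0 : ℝ) ≤ m := Nat.cast_nonneg m
    nlinarith
  obtain ⟨m, hm⟩ : ∃ m, Nat.find hex = m + 1 := by
    refine Nat.exists_eq_succ_of_ne_zero fun h0 => ?_
    have := Nat.find_spec hex
    rw [h0] at this
    norm_num at this
    linarith
  have h1 := Nat.find_spec hex
  have h2 := Nat.find_min hex (m := m) (by omega)
  rw [hm] at h1
  have hI : IsFoldIndex a (m + 1) := by
    refine ⟨by omega, ?_, h1⟩
    push Not at h2
    push_cast
    linarith
  exact ⟨m + 1, hI, fun k hk => le_antisymm (huniq _ _ hk hI) (huniq _ _ hI hk)⟩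

open Classical in
/-- The function `s_PB(a) = (a - 2π)/(2k) + (k + 2)π`, where `k` is the integer with
`2(k² - k + 1) < a/π ≤ 2(k² + k + 1)`. Its domain is `a > 2π` (the value is `0` otherwise). -/
noncomputable def sPB (a : ℝ) : ℝ :=
  if h : ∃ k : ℕ, IsFoldIndex a k then
    (a - 2 * π) / (2 * (Nat.find h : ℝ)) + ((Nat.find h : ℝ) + 2) * π
  else 0

theorem sPB_eq {a : ℝ} {k : ℕ} (ha : 2 * π < a) (hk : IsFoldIndex a k) :
    sPB a = (a - 2 * π) / (2 * (k : ℝ)) + ((k : ℝ) + 2) * π := by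
  classical
  have h : ∃ k : ℕ, IsFoldIndex a k := ⟨k, hk⟩
  have : Nat.find h = k := (existsUnique_isFoldIndex ha).unique (Nat.find_spec h) hk
  rw [sPB, dif_pos h, this]

open scoped Topology

/-!
This is multiple symplectic folding. Area-preserving maps turn the two discs of the polydisc into a
rectangle `0 < u < w`, `0 < v < 1` and into a comb-shaped region `G` of points `q + ip`,
`0 < p < 2k`, whose vertical slices `l p < q < u p` are intervals. In action-angle coordinates
`(u, v)` and `(q, p)`, where `v` and `p` only matter modulo `1`, the ball of capacity `A` is
`u + q < A`. Over each unit interval of `p` the rectangle is shifted in the direction of `u` by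
`0`, `w`, `2w`, …, so that the pieces of `G`, which wrap around the circle of angles, are disjoint.

Two consecutive pieces are joined by a fold: the Hamiltonian `ρ(q) (v - c)`, with `ρ` climbing from
one plateau to the next along a length `L ≈ w` of `q`, lifts the rectangle by `ρ(q)` and moves `p`
by at most `ρ' < 1`, so the fold does not meet itself after reduction modulo `1`. The folds sit
alternately on top of the teeth of the comb and at their bottoms. To stay below `u + q = A`, each
tooth must be shorter than the previous one by about `2w`; adding up the areas of the `k` teeth
gives `s_PB`, up to an arbitrarily small error.
-/

section PreservesForm

variable {E : Type*} [NormedAddCommGroup E] [NormedSpace ℝ E] {Ω : E → E → ℝ} {φ ψ : E → E}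
  {U V W : Set E} {z : E}

/-- `φ` is smooth at `z` and `φ^* Ω = Ω` there, for a constant two-form `Ω` on `E`. As bilinearity
is never needed, `Ω` may be any function of two vectors. -/
structure PreservesFormAt (Ω : E → E → ℝ) (φ : E → E) (z : E) : Prop where
  contDiffAt : ContDiffAt ℝ ∞ φ z
  pullback_eq : ∀ v w, Ω (fderiv ℝ φ z v) (fderiv ℝ φ z w) = Ω v w

/-- `φ` maps `U` injectively and smoothly into `V` and preserves `Ω` on `U`. For nondegenerate `Ω`
and open `U` it is then an embedding. -/
structure IsFormEmbedding (Ω : E → E → ℝ) (φ : E → E) (U V : Set E) : Prop where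
  preservesFormAt : ∀ z ∈ U, PreservesFormAt Ω φ z
  injOn : U.InjOn φ
  mapsTo : U.MapsTo φ V

namespace PreservesFormAt

theorem of_hasFDerivAt {φ' : E →L[ℝ] E} (hφ : ContDiffAt ℝ ∞ φ z) (hφ' : HasFDerivAt φ φ' z)
    (h : ∀ v w, Ω (φ' v) (φ' w) = Ω v w) : PreservesFormAt Ω φ z :=
  ⟨hφ, by rwa [hφ'.fderiv]⟩

theorem hasFDerivAt (h : PreservesFormAt Ω φ z) : HasFDerivAt φ (fderiv ℝ φ z) z :=
  (h.contDiffAt.differentiableAt (by simp)).hasFDerivAt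

theorem comp (hψ : PreservesFormAt Ω ψ (φ z)) (hφ : PreservesFormAt Ω φ z) :
    PreservesFormAt Ω (ψ ∘ φ) z :=
  of_hasFDerivAt (hψ.contDiffAt.comp z hφ.contDiffAt) (hψ.hasFDerivAt.comp z hφ.hasFDerivAt)
    fun v w => (hψ.pullback_eq _ _).trans (hφ.pullback_eq v w)

theorem congr_of_eventuallyEq (hφ : PreservesFormAt Ω φ z) (h : ψ =ᶠ[𝓝 z] φ) :
    PreservesFormAt Ω ψ z :=
  of_hasFDerivAt (hφ.contDiffAt.congr_of_eventuallyEq h) (hφ.hasFDerivAt.congr_of_eventuallyEq h)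
    hφ.pullback_eq

theorem fderiv_injective (hΩ : Function.Injective Ω) (hφ : PreservesFormAt Ω φ z) :
    Function.Injective (fderiv ℝ φ z) := fun v v' h =>
  hΩ <| funext fun w => by rw [← hφ.pullback_eq v w, h, hφ.pullback_eq]

theorem map_nhds_eq [FiniteDimensional ℝ E] (hΩ : Function.Injective Ω)
    (hφ : PreservesFormAt Ω φ z) : Filter.map φ (𝓝 z) = 𝓝 (φ z) := by
  have := FiniteDimensional.complete ℝ E
  let e : E ≃L[ℝ] E := (LinearEquiv.ofInjectiveEndo (fderiv ℝ φ z : E →ₗ[ℝ] E)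
    (hφ.fderiv_injective hΩ)).toContinuousLinearEquiv
  have he : (e : E →L[ℝ] E) = fderiv ℝ φ z := by
    ext1
    rfl
  have hstrict : HasStrictFDerivAt φ (e : E →L[ℝ] E) z := by
    rw [he]
    exact hφ.contDiffAt.hasStrictFDerivAt (by simp)
  exact hstrict.map_nhds_eq_of_equiv

end PreservesFormAt

namespace IsFormEmbedding

theorem comp (hψ : IsFormEmbedding Ω ψ V W) (hφ : IsFormEmbedding Ω φ U V) :
    IsFormEmbedding Ω (ψ ∘ φ) U W where
  preservesFormAt z hz := (hψ.preservesFormAt _ (hφ.mapsTo hz)).comp (hφ.preservesFormAt z hz)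
  injOn := hψ.injOn.comp hφ.injOn hφ.mapsTo
  mapsTo := hψ.mapsTo.comp hφ.mapsTo

theorem isOpenEmbedding_domRestrict [FiniteDimensional ℝ E] (hΩ : Function.Injective Ω)
    (hU : IsOpen U) (hφ : IsFormEmbedding Ω φ U V) :
    Topology.IsOpenEmbedding (U.domRestrict φ) := by
  have hcont : ContinuousOn φ U := fun z hz =>
    (hφ.preservesFormAt z hz).contDiffAt.continuousAt.continuousWithinAt
  refine .of_continuous_injective_isOpenMap hcont.domRestrict hφ.injOn.injective <|
    IsOpenMap.of_nhds_le fun z => ?_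
  have hmap : Filter.map (U.domRestrict φ) (𝓝 z) = Filter.map φ (Filter.map (↑) (𝓝 z)) := rfl
  rw [hmap, hU.isOpenEmbedding_subtypeVal.map_nhds_eq,
    (hφ.preservesFormAt z z.2).map_nhds_eq hΩ]
  rfl

end IsFormEmbedding

end PreservesForm

/-- The standard area form `dx ∧ dy` of the plane. -/
def areaForm (v w : ℂ) : ℝ := v.re * w.im - v.im * w.re

theorem areaForm_mul_right (v w c : ℂ) : areaForm (v * c) (w * c) = ‖c‖ ^ 2 * areaForm v w := by
  rw [← Complex.normSq_eq_norm_sq, Complex.normSq_apply]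
  simp only [areaForm, Complex.mul_re, Complex.mul_im]
  ring

theorem stdSymplecticForm_single {n : ℕ} (v : Fin n → ℂ) (i : Fin n) (c : ℂ) :
    stdSymplecticForm v (Pi.single i c) = areaForm (v i) c := by
  rw [stdSymplecticForm, Finset.sum_eq_single i]
  · simp [areaForm]
  · intro j _ hj
    simp [Pi.single_eq_of_ne hj]
  · simp

theorem stdSymplecticForm_injective {n : ℕ} :
    Function.Injective (stdSymplecticForm : (Fin n → ℂ) → (Fin n → ℂ) → ℝ) := by
  intro v v' h
  have harea (i : Fin n) (c : ℂ) : areaForm (v i) c = areaForm (v' i) c := by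
    rw [← stdSymplecticForm_single, h, stdSymplecticForm_single]
  funext i
  have hre := harea i Complex.I
  have him := harea i 1
  simp only [areaForm, Complex.I_re, Complex.I_im, Complex.one_re, Complex.one_im, mul_zero,
    mul_one, sub_zero, zero_sub, neg_inj] at hre him
  exact Complex.ext hre him

section Products

variable {n : ℕ} {g : Fin n → ℂ → ℂ}

theorem PreservesFormAt.pi {z : Fin n → ℂ} (hg : ∀ i, PreservesFormAt areaForm (g i) (z i)) :
    PreservesFormAt stdSymplecticForm (fun z i => g i (z i)) z := by
  have hcomp (i : Fin n) := (hg i).hasFDerivAt.comp z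
    (ContinuousLinearMap.proj (R := ℝ) (φ := fun _ : Fin n => ℂ) i).hasFDerivAt
  refine .of_hasFDerivAt (contDiffAt_pi.2 fun i => ?_) (hasFDerivAt_pi.2 hcomp) fun v w => ?_
  · exact (hg i).contDiffAt.comp z (contDiff_apply ℝ ℂ i).contDiffAt
  · exact Finset.sum_congr rfl fun i _ => (hg i).pullback_eq (v i) (w i)

theorem IsFormEmbedding.pi {U V : Fin n → Set ℂ}
    (hg : ∀ i, IsFormEmbedding areaForm (g i) (U i) (V i)) :
    IsFormEmbedding stdSymplecticForm (fun z i => g i (z i)) (Set.univ.pi U) (Set.univ.pi V) where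
  preservesFormAt z hz := .pi fun i => (hg i).preservesFormAt (z i) (hz i trivial)
  injOn _ hz _ hz' h := funext fun i =>
    (hg i).injOn (hz i trivial) (hz' i trivial) (congrFun h i)
  mapsTo _ hz i _ := (hg i).mapsTo (hz i trivial)

theorem IsFormEmbedding.isSymplecticEmbedding {φ : (Fin n → ℂ) → (Fin n → ℂ)}
    {U V : Set (Fin n → ℂ)} (hφ : IsFormEmbedding stdSymplecticForm φ U V) (hU : IsOpen U) :
    IsSymplecticEmbedding φ U V where
  contDiffOn z hz := (hφ.preservesFormAt z hz).contDiffAt.contDiffWithinAt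
  isEmbedding := (hφ.isOpenEmbedding_domRestrict stdSymplecticForm_injective hU).isEmbedding
  pullback_eq z hz := (hφ.preservesFormAt z hz).pullback_eq
  mapsTo := hφ.mapsTo

end Products

theorem polydisc_eq_univ_pi {n : ℕ} (a : Fin n → ℝ) :
    polydisc a = Set.univ.pi fun i => openDisc (a i) := by
  ext z
  simp [polydisc]

theorem isOpen_openDisc (a : ℝ) : IsOpen (openDisc a) :=
  isOpen_lt (by fun_prop) continuous_const

theorem isOpen_polydisc {n : ℕ} (a : Fin n → ℝ) : IsOpen (polydisc a) := by
  rw [polydisc_eq_univ_pi]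
  exact isOpen_set_pi Set.finite_univ fun i _ => isOpen_openDisc (a i)

theorem contDiffAt_complexMk {E : Type*} [NormedAddCommGroup E] [NormedSpace ℝ E] {a b : E → ℝ}
    {z : E} {m : WithTop ℕ∞} (ha : ContDiffAt ℝ m a z) (hb : ContDiffAt ℝ m b z) :
    ContDiffAt ℝ m (fun z => (⟨a z, b z⟩ : ℂ)) z :=
  Complex.equivRealProdCLM.symm.contDiff.contDiffAt.comp z (ha.prodMk hb)

theorem hasFDerivAt_complexMk {E : Type*} [NormedAddCommGroup E] [NormedSpace ℝ E] {a b : E → ℝ}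
    {a' b' : E →L[ℝ] ℝ} {z : E} (ha : HasFDerivAt a a' z) (hb : HasFDerivAt b b' z) :
    HasFDerivAt (fun z => (⟨a z, b z⟩ : ℂ))
      ((Complex.equivRealProdCLM.symm : ℝ × ℝ →L[ℝ] ℂ).comp (a'.prod b')) z :=
  (Complex.equivRealProdCLM.symm : ℝ × ℝ →L[ℝ] ℂ).hasFDerivAt.comp z (ha.prodMk hb)

theorem preservesFormAt_areaForm_fibred {F G P : ℝ → ℝ} {z : ℂ} (hF : ContDiffAt ℝ ∞ F z.im)
    (hG : ContDiffAt ℝ ∞ G z.im) (hP : ContDiffAt ℝ ∞ P z.im) (h : G z.im * deriv P z.im = 1) :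
    PreservesFormAt areaForm (fun z => ⟨F z.im + z.re * G z.im, P z.im⟩) z := by
  have hre : ContDiff ℝ ∞ Complex.re := Complex.reCLM.contDiff
  have him : ContDiff ℝ ∞ Complex.im := Complex.imCLM.contDiff
  have hcomp {f : ℝ → ℝ} (hf : ContDiffAt ℝ ∞ f z.im) :
      HasFDerivAt (fun z : ℂ => f z.im) (deriv f z.im • Complex.imCLM) z :=
    (hf.differentiableAt (by simp)).hasDerivAt.comp_hasFDerivAt z Complex.imCLM.hasFDerivAt
  refine .of_hasFDerivAt (contDiffAt_complexMk ((hF.comp z him.contDiffAt).add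
    (hre.contDiffAt.mul (hG.comp z him.contDiffAt))) (hP.comp z him.contDiffAt))
    (hasFDerivAt_complexMk ((hcomp hF).add (Complex.reCLM.hasFDerivAt.mul (hcomp hG)))
      (hcomp hP)) fun v w => ?_
  simp only [areaForm, Complex.reCLM_apply, ContinuousLinearMap.comp_apply,
    ContinuousLinearMap.prod_apply, add_apply, smul_apply, Complex.imCLM_apply, smul_eq_mul,
    ContinuousLinearEquiv.coe_coe, Complex.equivRealProdCLM_symm_apply_re,
    Complex.equivRealProdCLM_symm_apply_im]
  linear_combination (v.re * w.im - v.im * w.re) * h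

/-- Action-angle coordinates on the punctured plane: `z.re` is the action (the area enclosed by
the circle through the image point), and `z.im` is the angle, measured in full turns. -/
noncomputable def actionAngle (z : ℂ) : ℂ :=
  √(z.re / π) * Complex.exp (2 * π * z.im * Complex.I)

theorem norm_exp_two_pi_mul_I (y : ℝ) : ‖Complex.exp (2 * π * y * Complex.I)‖ = 1 := by
  exact_mod_cast Complex.norm_exp_ofReal_mul_I (2 * π * y)

theorem pi_mul_norm_actionAngle_sq {z : ℂ} (hz : 0 ≤ z.re) : π * ‖actionAngle z‖ ^ 2 = z.re := by
  rw [actionAngle, norm_mul, norm_exp_two_pi_mul_I, mul_one, Complex.norm_real, Real.norm_eq_abs,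
    sq_abs, Real.sq_sqrt (div_nonneg hz Real.pi_pos.le), mul_div_cancel₀ _ Real.pi_ne_zero]

theorem re_eq_and_im_eq_add_int_of_actionAngle_eq {z z' : ℂ} (hz : 0 < z.re) (hz' : 0 < z'.re)
    (h : actionAngle z = actionAngle z') : z.re = z'.re ∧ ∃ m : ℤ, z.im = z'.im + m := by
  have hre : z.re = z'.re := by
    rw [← pi_mul_norm_actionAngle_sq hz.le, h, pi_mul_norm_actionAngle_sq hz'.le]
  have hradius : (√(z'.re / π) : ℂ) ≠ 0 :=
    Complex.ofReal_ne_zero.2 (Real.sqrt_pos.2 (div_pos hz' Real.pi_pos)).ne'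
  rw [actionAngle, actionAngle, hre] at h
  obtain ⟨m, hm⟩ := Complex.exp_eq_exp_iff_exists_int.1 (mul_left_cancel₀ hradius h)
  refine ⟨hre, m, ?_⟩
  have hturns : 2 * π * Complex.I * (z.im : ℂ) = 2 * π * Complex.I * (z'.im + m : ℝ) := by
    push_cast
    linear_combination hm
  exact_mod_cast mul_left_cancel₀ Complex.two_pi_I_ne_zero hturns

theorem contDiffAt_actionAngle {z : ℂ} (hz : 0 < z.re) : ContDiffAt ℝ ∞ actionAngle z := by
  have hradius : ContDiffAt ℝ ∞ (fun z : ℂ => √(z.re / π)) z :=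
    (Complex.reCLM.contDiff.div_const π).contDiffAt.sqrt (div_pos hz Real.pi_pos).ne'
  have hphase : ContDiff ℝ ∞ fun z : ℂ => Complex.exp (2 * π * z.im * Complex.I) :=
    ((contDiff_const.mul (Complex.ofRealCLM.contDiff.comp Complex.imCLM.contDiff)).mul
      contDiff_const).cexp
  exact (Complex.ofRealCLM.contDiff.contDiffAt.comp z hradius).mul hphase.contDiffAt

theorem fderiv_actionAngle_apply {z : ℂ} (hz : 0 < z.re) (v : ℂ) :
    fderiv ℝ actionAngle z v = ⟨v.re / (2 * π * √(z.re / π)), 2 * π * √(z.re / π) * v.im⟩ *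
      Complex.exp (2 * π * z.im * Complex.I) := by
  have hradius : HasFDerivAt (fun z : ℂ => (√(z.re / π) : ℂ)) _ z :=
    Complex.ofRealCLM.hasFDerivAt.comp z
      ((Complex.reCLM.hasFDerivAt.mul_const π⁻¹).sqrt (div_pos hz Real.pi_pos).ne')
  have hphase := (((Complex.ofRealCLM.hasFDerivAt.comp z
    Complex.imCLM.hasFDerivAt).const_mul (2 * π : ℂ)).mul_const Complex.I).cexp
  rw [HasFDerivAt.fderiv (f := actionAngle) (hradius.mul hphase), Complex.mk_eq_add_mul_I]
  simp only [div_eq_mul_inv, Function.comp_apply, Complex.imCLM_apply, Complex.ofRealCLM_apply,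
    Complex.coe_smul, Complex.reCLM_apply, mul_inv_rev, one_mul, ContinuousLinearMap.comp_smulₛₗ,
    Real.ringHom_apply, map_inv₀, add_apply, smul_apply, ContinuousLinearMap.comp_apply,
    smul_eq_mul, Complex.real_smul, Complex.ofReal_inv, Complex.ofReal_mul, Complex.ofReal_ofNat]
  ring

theorem preservesFormAt_actionAngle {z : ℂ} (hz : 0 < z.re) :
    PreservesFormAt areaForm actionAngle z := by
  have hr : √(z.re / π) ≠ 0 := (Real.sqrt_pos.2 (div_pos hz Real.pi_pos)).ne'
  refine ⟨contDiffAt_actionAngle hz, fun v w => ?_⟩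
  rw [fderiv_actionAngle_apply hz, fderiv_actionAngle_apply hz, areaForm_mul_right,
    norm_exp_two_pi_mul_I]
  simp only [areaForm]
  field_simp

theorem contDiff_primitive {h : ℝ → ℝ} (hh : ContDiff ℝ ∞ h) (a : ℝ) :
    ContDiff ℝ ∞ fun x => ∫ t in a..x, h t := by
  have hderiv : deriv (fun x => ∫ t in a..x, h t) = h :=
    funext fun x => hh.continuous.deriv_integral h a x
  rw [contDiff_infty_iff_deriv, hderiv]
  exact ⟨fun x => (hh.continuous.integral_hasStrictDerivAt a x).hasDerivAt.differentiableAt, hh⟩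

theorem exists_smooth_leftInverse_of_deriv_pos {H : ℝ → ℝ} (hH : ContDiff ℝ ∞ H)
    (hpos : ∀ x, 0 < deriv H x) :
    ∃ P : ℝ → ℝ, Function.LeftInverse P H ∧
      ∀ x, ContDiffAt ℝ ∞ P (H x) ∧ HasDerivAt P (deriv H x)⁻¹ (H x) := by
  have hderiv (x : ℝ) : HasStrictDerivAt H (deriv H x) x :=
    hH.contDiffAt.hasStrictDerivAt (by simp)
  have hemb : Topology.IsOpenEmbedding H :=
    .of_continuous_injective_isOpenMap hH.continuous (strictMono_of_deriv_pos hpos).injective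
      (isOpenMap_of_hasStrictDerivAt hderiv fun x => (hpos x).ne')
  let e := hemb.toOpenPartialHomeomorph H
  have hleft : Function.LeftInverse e.symm H := fun x => e.left_inv (Set.mem_univ x)
  have htarget (x : ℝ) : H x ∈ e.target := e.map_source (Set.mem_univ x)
  refine ⟨e.symm, hleft, fun x => ?_⟩
  have hderiv_symm : HasDerivAt e (deriv H x) (e.symm (H x)) := by
    rw [hleft x]
    exact (hderiv x).hasDerivAt
  exact ⟨e.contDiffAt_symm_deriv (hpos x).ne' (htarget x) hderiv_symm hH.contDiffAt,
    e.hasDerivAt_symm (htarget x) (hpos x).ne' hderiv_symm⟩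

/-- The area of the part below height `y` of the disc of radius `R`, up to an additive constant: an
antiderivative of the width `2 √(R² - y²)`, normalised to vanish at `0`. -/
noncomputable def discArea (R y : ℝ) : ℝ := y * √(R ^ 2 - y ^ 2) + R ^ 2 * Real.arcsin (y / R)

theorem discArea_neg (R y : ℝ) : discArea R (-y) = -discArea R y := by
  simp only [discArea, neg_sq, neg_div, Real.arcsin_neg]
  ring

theorem discArea_self {R : ℝ} (hR : R ≠ 0) : discArea R R = π * R ^ 2 / 2 := by
  simp only [discArea, sub_self, Real.sqrt_zero, mul_zero, zero_add, div_self hR, Real.arcsin_one]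
  ring

section DiscArea

variable {R y : ℝ}

theorem sq_sub_sq_pos_of_abs_lt (hy : |y| < R) : 0 < R ^ 2 - y ^ 2 :=
  sub_pos.2 (sq_lt_sq.2 (hy.trans_le (le_abs_self R)))

theorem abs_div_lt_one_of_abs_lt (hy : |y| < R) : |y / R| < 1 := by
  have hR : 0 < R := (abs_nonneg y).trans_lt hy
  rwa [abs_div, abs_of_pos hR, div_lt_one hR]

theorem contDiffAt_discArea (hy : |y| < R) : ContDiffAt ℝ ∞ (discArea R) y := by
  obtain ⟨hlow, hhigh⟩ := abs_lt.1 (abs_div_lt_one_of_abs_lt hy)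
  have harcsin : ContDiffAt ℝ ∞ (fun y : ℝ => Real.arcsin (y / R)) y :=
    ContDiffAt.comp (g := Real.arcsin) y (Real.contDiffAt_arcsin hlow.ne' hhigh.ne)
      (contDiffAt_id.div_const R)
  exact (contDiffAt_id.mul ((contDiffAt_const.sub (contDiffAt_id.pow 2)).sqrt
    (sq_sub_sq_pos_of_abs_lt hy).ne')).add (contDiffAt_const.mul harcsin)

theorem hasDerivAt_discArea (hy : |y| < R) :
    HasDerivAt (discArea R) (2 * √(R ^ 2 - y ^ 2)) y := by
  have hR : 0 < R := (abs_nonneg y).trans_lt hy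
  have hpos : 0 < R ^ 2 - y ^ 2 := sq_sub_sq_pos_of_abs_lt hy
  obtain ⟨hlow, hhigh⟩ := abs_lt.1 (abs_div_lt_one_of_abs_lt hy)
  have hsqrt := ((hasDerivAt_pow 2 y).const_sub (R ^ 2)).sqrt hpos.ne'
  have harcsin := (Real.hasDerivAt_arcsin hlow.ne' hhigh.ne).comp y
    ((hasDerivAt_id y).div_const R)
  refine (((hasDerivAt_id y).mul hsqrt).add (harcsin.const_mul (R ^ 2))).congr_deriv ?_
  have hscale : √(1 - (y / R) ^ 2) = √(R ^ 2 - y ^ 2) / R := by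
    have hsplit : 1 - (y / R) ^ 2 = (R ^ 2 - y ^ 2) / R ^ 2 := by field_simp
    rw [hsplit, Real.sqrt_div hpos.le, Real.sqrt_sq hR.le]
  have hne : √(R ^ 2 - y ^ 2) ≠ 0 := (Real.sqrt_pos.2 hpos).ne'
  rw [hscale]
  simp only [id, Nat.cast_ofNat, Nat.add_one_sub_one, pow_one]
  field_simp
  linear_combination -Real.sq_sqrt hpos.le

theorem strictMonoOn_discArea (R : ℝ) : StrictMonoOn (discArea R) (Set.Icc (-R) R) := by
  refine strictMonoOn_of_deriv_pos (convex_Icc _ _) ?_ fun y hy => ?_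
  · unfold discArea
    fun_prop
  · rw [interior_Icc] at hy
    have hpos := sq_sub_sq_pos_of_abs_lt (abs_lt.2 hy)
    rw [(hasDerivAt_discArea (abs_lt.2 hy)).deriv]
    positivity

theorem abs_discArea_lt (hy : |y| < R) : |discArea R y| < π * R ^ 2 / 2 := by
  have hR : 0 < R := (abs_nonneg y).trans_lt hy
  obtain ⟨hlow, hhigh⟩ := abs_lt.1 hy
  rw [abs_lt, ← discArea_self hR.ne', ← discArea_neg]
  exact ⟨strictMonoOn_discArea R ⟨le_rfl, by linarith⟩ ⟨hlow.le, hhigh.le⟩ hlow,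
    strictMonoOn_discArea R ⟨hlow.le, hhigh.le⟩ ⟨by linarith, le_rfl⟩ hhigh⟩

end DiscArea

theorem abs_im_lt_and_abs_re_lt_of_mem_openDisc {R : ℝ} (hR : 0 ≤ R) {z : ℂ}
    (hz : z ∈ openDisc (π * R ^ 2)) : |z.im| < R ∧ |z.re| < √(R ^ 2 - z.im ^ 2) := by
  have hsq : ‖z‖ ^ 2 < R ^ 2 := lt_of_mul_lt_mul_left hz Real.pi_pos.le
  rw [← Complex.normSq_eq_norm_sq, Complex.normSq_apply] at hsq
  refine ⟨abs_lt_of_sq_lt_sq (by nlinarith) hR, Real.lt_sqrt_of_sq_lt ?_⟩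
  rw [sq_abs]
  linarith

/-- The part of the strip `0 < y < N` between the graphs `x = l y` and `x = u y`. -/
def fibredRegion (N : ℝ) (l u : ℝ → ℝ) : Set ℂ :=
  {z | z.im ∈ Set.Ioo 0 N ∧ z.re ∈ Set.Ioo (l z.im) (u z.im)}

theorem exists_height_matching_discArea {h : ℝ → ℝ} (hh : ContDiff ℝ ∞ h) (hpos : ∀ y, 0 < h y)
    {N R : ℝ} (hN : 0 ≤ N) (hR : π * R ^ 2 ≤ ∫ y in (0 : ℝ)..N, h y) :
    ∃ p : ℝ → ℝ, Set.InjOn p {y | |y| < R} ∧ ∀ y, |y| < R → p y ∈ Set.Ioo 0 N ∧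
      ContDiffAt ℝ ∞ p y ∧ h (p y) * deriv p y = 2 * √(R ^ 2 - y ^ 2) := by
  let H : ℝ → ℝ := fun x => ∫ t in (0 : ℝ)..x, h t
  have hH : ContDiff ℝ ∞ H := contDiff_primitive hh 0
  have hderiv (x : ℝ) : deriv H x = h x := hh.continuous.deriv_integral h 0 x
  obtain ⟨P, hleft, hP⟩ := exists_smooth_leftInverse_of_deriv_pos hH fun x => by
    rw [hderiv]
    exact hpos x
  let s : ℝ → ℝ := fun y => discArea R y + π * R ^ 2 / 2
  have hheight (y : ℝ) (hy : |y| < R) : ∃ x ∈ Set.Ioo 0 N, H x = s y := by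
    obtain ⟨hlow, hhigh⟩ := abs_lt.1 (abs_discArea_lt hy)
    have hs : s y ∈ Set.Ioo (H 0) (H N) := by
      simp only [s, H, intervalIntegral.integral_same]
      constructor <;> linarith
    exact intermediate_value_Ioo hN hH.continuous.continuousOn hs
  refine ⟨P ∘ s, fun y hy y' hy' heq => ?_, fun y hy => ?_⟩
  · obtain ⟨x, -, hx⟩ := hheight y hy
    obtain ⟨x', -, hx'⟩ := hheight y' hy'
    have hs : s y = s y' := by
      rw [Function.comp_apply, Function.comp_apply, ← hx, ← hx', hleft, hleft] at heq
      rw [← hx, ← hx', heq]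
    exact (strictMonoOn_discArea R).injOn (abs_le.1 (le_of_lt hy)) (abs_le.1 (le_of_lt hy'))
      (add_right_cancel hs)
  · obtain ⟨x, hxN, hx⟩ := hheight y hy
    have hPs : (P ∘ s) y = x := by rw [Function.comp_apply, ← hx, hleft]
    obtain ⟨hPsmooth, hPderiv⟩ := hP x
    rw [hx] at hPsmooth hPderiv
    have hs : HasDerivAt s (2 * √(R ^ 2 - y ^ 2)) y := (hasDerivAt_discArea hy).add_const _
    refine ⟨hPs ▸ hxN, hPsmooth.comp y ((contDiffAt_discArea hy).add contDiffAt_const), ?_⟩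
    rw [(hPderiv.comp y hs).deriv, hPs, hderiv, mul_inv_cancel_left₀ (hpos x).ne']

theorem exists_isFormEmbedding_openDisc_fibredRegion {l u : ℝ → ℝ} (hl : ContDiff ℝ ∞ l)
    (hu : ContDiff ℝ ∞ u) (hlu : ∀ y, l y < u y) {N a : ℝ} (hN : 0 ≤ N) (ha : 0 < a)
    (harea : a ≤ ∫ y in (0 : ℝ)..N, (u y - l y)) :
    ∃ g, IsFormEmbedding areaForm g (openDisc a) (fibredRegion N l u) := by
  obtain ⟨R, hR, rfl⟩ : ∃ R > 0, π * R ^ 2 = a :=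
    ⟨√(a / π), Real.sqrt_pos.2 (div_pos ha Real.pi_pos), by
      rw [Real.sq_sqrt (div_pos ha Real.pi_pos).le, mul_div_cancel₀ _ Real.pi_ne_zero]⟩
  obtain ⟨p, hpinj, hp⟩ := exists_height_matching_discArea (hu.sub hl)
    (fun y => sub_pos.2 (hlu y)) hN harea
  let mid : ℝ → ℝ := fun y => (l (p y) + u (p y)) / 2
  let stretch : ℝ → ℝ := fun y => (u (p y) - l (p y)) / (2 * √(R ^ 2 - y ^ 2))
  have hwidth {z : ℂ} (hz : z ∈ openDisc (π * R ^ 2)) : 0 < √(R ^ 2 - z.im ^ 2) :=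
    Real.sqrt_pos.2 (sq_sub_sq_pos_of_abs_lt (abs_im_lt_and_abs_re_lt_of_mem_openDisc hR.le hz).1)
  have hstretch {z : ℂ} (hz : z ∈ openDisc (π * R ^ 2)) : 0 < stretch z.im :=
    div_pos (sub_pos.2 (hlu _)) (mul_pos two_pos (hwidth hz))
  refine ⟨fun z => ⟨mid z.im + z.re * stretch z.im, p z.im⟩, ?_, ?_, ?_⟩
  · intro z hz
    obtain ⟨him, -⟩ := abs_im_lt_and_abs_re_lt_of_mem_openDisc hR.le hz
    obtain ⟨-, hsmooth, hderiv⟩ := hp z.im him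
    have hlp := hl.contDiffAt.comp z.im hsmooth
    have hup := hu.contDiffAt.comp z.im hsmooth
    refine preservesFormAt_areaForm_fibred ((hlp.add hup).div_const 2) ((hup.sub hlp).div
      (contDiffAt_const.mul ((contDiffAt_const.sub (contDiffAt_id.pow 2)).sqrt
        (sq_sub_sq_pos_of_abs_lt him).ne')) (mul_pos two_pos (hwidth hz)).ne') hsmooth ?_
    rw [div_mul_eq_mul_div, hderiv, div_self (mul_pos two_pos (hwidth hz)).ne']
  · intro z hz z' hz' heq
    have him : z.im = z'.im := hpinj (abs_im_lt_and_abs_re_lt_of_mem_openDisc hR.le hz).1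
      (abs_im_lt_and_abs_re_lt_of_mem_openDisc hR.le hz').1 (congrArg Complex.im heq)
    have hre := congrArg Complex.re heq
    simp only [← him, add_right_inj] at hre
    exact Complex.ext (mul_right_cancel₀ (hstretch hz).ne' hre) him
  · intro z hz
    obtain ⟨him, hre⟩ := abs_im_lt_and_abs_re_lt_of_mem_openDisc hR.le hz
    have hhalf : √(R ^ 2 - z.im ^ 2) * stretch z.im = (u (p z.im) - l (p z.im)) / 2 := by
      have hne := (hwidth hz).ne'
      simp only [stretch]
      field_simp
    obtain ⟨hlow, hhigh⟩ := abs_lt.1 hre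
    refine ⟨(hp z.im him).1, ?_, ?_⟩ <;> simp only [mid] <;> nlinarith [hstretch hz]

/-- `c` is a smooth monotone transition from the value `0` on `(-∞, d]` to the value `w` on
`[L, ∞)` with slope at most `μ`. -/
structure IsSmoothStep (c : ℝ → ℝ) (d L w μ : ℝ) : Prop where
  contDiff : ContDiff ℝ ∞ c
  eq_zero : ∀ s ≤ d, c s = 0
  eq_height : ∀ s, L ≤ s → c s = w
  deriv_nonneg : ∀ s, 0 ≤ deriv c s
  deriv_le : ∀ s, deriv c s ≤ μ

namespace IsSmoothStep

variable {c : ℝ → ℝ} {d L w μ : ℝ}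

theorem differentiable (hc : IsSmoothStep c d L w μ) : Differentiable ℝ c :=
  hc.contDiff.differentiable (by simp)

theorem monotone (hc : IsSmoothStep c d L w μ) : Monotone c :=
  monotone_of_deriv_nonneg hc.differentiable hc.deriv_nonneg

theorem nonneg (hc : IsSmoothStep c d L w μ) (s : ℝ) : 0 ≤ c s :=
  (hc.eq_zero _ (min_le_right s d)).ge.trans (hc.monotone (min_le_left s d))

theorem le_height (hc : IsSmoothStep c d L w μ) (s : ℝ) : c s ≤ w :=
  (hc.monotone (le_max_left s L)).trans (hc.eq_height _ (le_max_right s L)).le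

theorem le_self (hc : IsSmoothStep c d L w μ) (hμ : μ ≤ 1) (hd : 0 ≤ d) {s : ℝ} (hs : 0 ≤ s) :
    c s ≤ s := by
  have hgrowth := image_sub_le_mul_sub_of_deriv_le hc.differentiable
    (fun s => (hc.deriv_le s).trans hμ) hs
  rw [hc.eq_zero 0 hd] at hgrowth
  linarith

end IsSmoothStep

theorem exists_isSmoothStep {d L w μ : ℝ} (hw : 0 < w) (hμ : 0 < μ) (hwL : w < μ * (L - d)) :
    ∃ c, IsSmoothStep c d L w μ := by
  have hr : 0 < w / (2 * μ) := by positivity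
  have hrR : w / (2 * μ) < (L - d) / 2 := by
    rw [div_lt_div_iff₀ (by positivity) two_pos]
    linarith
  let b : ContDiffBump ((d + L) / 2) := ⟨w / (2 * μ), (L - d) / 2, hr, hrR⟩
  let g : ℝ → ℝ := fun s => w * b.normed MeasureTheory.volume s
  have hg : ContDiff ℝ ∞ g := contDiff_const.mul b.contDiff_normed
  have hderiv (s : ℝ) : deriv (fun s => ∫ t in d..s, g t) s = g s :=
    hg.continuous.deriv_integral g d s
  have hsupp : Function.support (b.normed MeasureTheory.volume) = Set.Ioo d L := by
    rw [b.support_normed_eq, Real.ball_eq_Ioo]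
    congr 1 <;> simp only [b] <;> ring
  refine ⟨fun s => ∫ t in d..s, g t, contDiff_primitive hg d, fun s hs => ?_, fun s hs => ?_,
    fun s => ?_, fun s => ?_⟩
  · refine intervalIntegral.integral_zero_ae (Filter.Eventually.of_forall fun t ht => ?_)
    have ht : t ∉ Function.support (b.normed MeasureTheory.volume) := by
      rw [hsupp]
      exact fun h => h.1.not_ge (ht.2.trans (max_le le_rfl hs))
    rw [Function.notMem_support] at ht
    simp only [g, ht, mul_zero]
  · have hsub : Function.support (b.normed MeasureTheory.volume) ⊆ Set.Ioc d s := by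
      rw [hsupp]
      exact fun t ht => ⟨ht.1, ht.2.le.trans hs⟩
    simp only [g, intervalIntegral.integral_const_mul]
    rw [intervalIntegral.integral_eq_integral_of_support_subset hsub, b.integral_normed, mul_one]
  · rw [hderiv]
    exact mul_nonneg hw.le (b.nonneg_normed s)
  · rw [hderiv]
    calc g s ≤ w * (1 / MeasureTheory.volume.real (Metric.closedBall ((d + L) / 2) b.rIn)) :=
          mul_le_mul_of_nonneg_left (b.normed_le_div_measure_closedBall_rIn _ s) hw.le
      _ = w * (1 / (2 * (w / (2 * μ)))) := by rw [Real.volume_real_closedBall hr.le]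
      _ = μ := by field_simp

theorem exists_contDiff_forall_mem_of_isOpen_of_convex {E F : Type*} [NormedAddCommGroup E]
    [NormedSpace ℝ E] [FiniteDimensional ℝ E] [NormedAddCommGroup F] [NormedSpace ℝ F]
    {t : E → Set F} (hconvex : ∀ x, Convex ℝ (t x)) (hopen : ∀ y, IsOpen {x | y ∈ t x})
    (hne : ∀ x, (t x).Nonempty) : ∃ g : E → F, ContDiff ℝ ∞ g ∧ ∀ x, g x ∈ t x := by
  obtain ⟨g, hg⟩ := exists_contMDiffMap_forall_mem_convex_of_local_const (n := ⊤)
    (modelWithCornersSelf ℝ E) hconvex fun x =>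
      (hne x).imp fun y hy => (hopen y).mem_nhds hy
  exact ⟨g, g.contMDiff.contDiff, hg⟩

theorem isOpen_setOf_forall_lt_imp {X : Type*} [TopologicalSpace X] {K : ℕ → Set X}
    (hK : ∀ i, IsClosed (K i)) (n : ℕ) (C : ℕ → Prop) :
    IsOpen {x | ∀ i < n, x ∈ K i → C i} := by
  simp only [Set.ofPred_forall]
  refine (Set.finite_lt_nat n).isOpen_biInter fun i _ => ?_
  simp only [imp_iff_not_or, Set.ofPred_or]
  exact (hK i).isOpen_compl.union isOpen_const

theorem mul_sum_le_integral_of_forall_window {f : ℝ → ℝ} (hf : Continuous f) (hf₀ : ∀ p, 0 ≤ f p)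
    {δ : ℝ} (hδ : 0 ≤ δ) (hδ' : 2 * δ ≤ 1) {n : ℕ} {h : ℕ → ℝ}
    (hh : ∀ j < n, ∀ p ∈ Set.Icc (j + δ) (j + 1 - δ), h j ≤ f p) :
    (1 - 2 * δ) * ∑ j ∈ Finset.range n, h j ≤ ∫ p in (0 : ℝ)..n, f p := by
  have hint (a b : ℝ) : IntervalIntegrable f MeasureTheory.volume a b := hf.intervalIntegrable a b
  have hsplit := intervalIntegral.sum_integral_adjacent_intervals (f := f)
    (a := fun j : ℕ => (j : ℝ)) (n := n) fun j _ => hint j (j + 1 : ℕ)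
  rw [Nat.cast_zero] at hsplit
  rw [← hsplit, Finset.mul_sum]
  refine Finset.sum_le_sum fun j hj => ?_
  have hle : (j : ℝ) + δ ≤ j + 1 - δ := by linarith
  calc (1 - 2 * δ) * h j = ∫ _ in (j + δ : ℝ)..(j + 1 - δ), h j := by
        rw [intervalIntegral.integral_const, smul_eq_mul]
        ring
    _ ≤ ∫ p in (j + δ : ℝ)..(j + 1 - δ), f p :=
        intervalIntegral.integral_mono_on hle (by simp) (hint _ _) (hh j (Finset.mem_range.1 hj))
    _ ≤ ∫ p in (j : ℝ)..(j + 1 : ℕ), f p :=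
        intervalIntegral.integral_mono_interval (by linarith) hle (by push_cast; linarith)
          (Filter.Eventually.of_forall hf₀) (hint _ _)

/-- The time-one flow of the Hamiltonian `r(q) (v - c)` in the coordinates `z 0 = u + iv`,
`z 1 = q + ip`. -/
noncomputable def hamiltonianShear (r : ℝ → ℝ) (c : ℝ) (z : Fin 2 → ℂ) : Fin 2 → ℂ :=
  ![⟨(z 0).re + r (z 1).re, (z 0).im⟩,
    ⟨(z 1).re, (z 1).im - deriv r (z 1).re * ((z 0).im - c)⟩]

section HamiltonianShear

variable {r : ℝ → ℝ} (c : ℝ)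

theorem contDiff_hamiltonianShear (hr : ContDiff ℝ ∞ r) :
    ContDiff ℝ ∞ (hamiltonianShear r c) := by
  have hr' : ContDiff ℝ ∞ (deriv r) := (contDiff_infty_iff_deriv.1 hr).2
  have hre (i : Fin 2) : ContDiff ℝ ∞ fun z : Fin 2 → ℂ => (z i).re :=
    Complex.reCLM.contDiff.comp (contDiff_apply ℝ ℂ i)
  have him (i : Fin 2) : ContDiff ℝ ∞ fun z : Fin 2 → ℂ => (z i).im :=
    Complex.imCLM.contDiff.comp (contDiff_apply ℝ ℂ i)
  refine contDiff_iff_contDiffAt.2 fun z => contDiffAt_pi.2 (Fin.forall_fin_two.2 ⟨?_, ?_⟩)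
  · exact contDiffAt_complexMk ((hre 0).add (hr.comp (hre 1))).contDiffAt (him 0).contDiffAt
  · exact contDiffAt_complexMk (hre 1).contDiffAt
      ((him 1).sub ((hr'.comp (hre 1)).mul ((him 0).sub contDiff_const))).contDiffAt

theorem fderiv_hamiltonianShear_apply (hr : ContDiff ℝ ∞ r) (z v : Fin 2 → ℂ) :
    fderiv ℝ (hamiltonianShear r c) z v =
      ![⟨(v 0).re + deriv r (z 1).re * (v 1).re, (v 0).im⟩,
        ⟨(v 1).re, (v 1).im - (deriv r (z 1).re * (v 0).im +
          ((z 0).im - c) * (deriv (deriv r) (z 1).re * (v 1).re))⟩] := by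
  let re (i : Fin 2) : (Fin 2 → ℂ) →L[ℝ] ℝ := Complex.reCLM.comp (.proj (φ := fun _ => ℂ) i)
  let im (i : Fin 2) : (Fin 2 → ℂ) →L[ℝ] ℝ := Complex.imCLM.comp (.proj (φ := fun _ => ℂ) i)
  have hcomp {f : ℝ → ℝ} (hf : ContDiff ℝ ∞ f) :
      HasFDerivAt (fun z => f (re 1 z)) (deriv f (re 1 z) • re 1) z :=
    (hf.differentiable (by simp) _).hasDerivAt.comp_hasFDerivAt z (re 1).hasFDerivAt
  have hr' : ContDiff ℝ ∞ (deriv r) := (contDiff_infty_iff_deriv.1 hr).2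
  have h₀ := hasFDerivAt_complexMk ((re 0).hasFDerivAt.add (hcomp hr)) (im 0).hasFDerivAt
  have h₁ := hasFDerivAt_complexMk (re 1).hasFDerivAt <|
    (im 1).hasFDerivAt.sub ((hcomp hr').mul ((im 0).hasFDerivAt.sub_const c))
  have h := hasFDerivAt_pi'.1
    ((contDiff_hamiltonianShear c hr).differentiable (by simp) z).hasFDerivAt
  exact funext <| Fin.forall_fin_two.2
    ⟨DFunLike.congr_fun ((h 0).unique h₀) v, DFunLike.congr_fun ((h 1).unique h₁) v⟩

theorem preservesFormAt_hamiltonianShear (hr : ContDiff ℝ ∞ r) (z : Fin 2 → ℂ) :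
    PreservesFormAt stdSymplecticForm (hamiltonianShear r c) z := by
  refine ⟨(contDiff_hamiltonianShear c hr).contDiffAt, fun v w => ?_⟩
  simp only [stdSymplecticForm, Fin.sum_univ_two, fderiv_hamiltonianShear_apply c hr,
    Matrix.cons_val_zero, Matrix.cons_val_one]
  ring

theorem hamiltonianShear_eq_of_eventuallyEq_const {b : ℝ} {z : Fin 2 → ℂ}
    (hr : r =ᶠ[𝓝 (z 1).re] fun _ => b) :
    hamiltonianShear r c z = ![⟨(z 0).re + b, (z 0).im⟩, z 1] := by
  rw [hamiltonianShear, hr.deriv_eq, hr.self_of_nhds, deriv_const, zero_mul, sub_zero]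

end HamiltonianShear

theorem eq_of_floor_eq_of_eq_add_int {s t : ℝ} {m : ℤ} (hfloor : ⌊s⌋ = ⌊t⌋) (h : s = t + m) :
    s = t := by
  have hm : m = 0 := by rwa [h, Int.floor_add_intCast, add_eq_left] at hfloor
  rw [h, hm, Int.cast_zero, add_zero]

/-- The data of a multiple symplectic fold: over the part of `G` with `j ≤ p < j + 1` the
rectangle `(0, w) × (0, 1)` is sheared by the Hamiltonian `ρ j (q) (v - c j)`, where
`z = q + ip ∈ G`. The profile `ρ j` climbs from the plateau `(j - 1) w` to the plateau `j w`, so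
that consecutive floors of the staircase stack up, and `d` measures the room left to separate them
modulo `1` in the `p`-direction. -/
structure IsStaircase (w d : ℝ) (ρ : ℕ → ℝ → ℝ) (c : ℕ → ℝ) (G : Set ℂ) : Prop where
  contDiff (j : ℕ) : ContDiff ℝ ∞ (ρ j)
  nonneg (j : ℕ) (q : ℝ) : 0 ≤ ρ j q
  le_plateau (j : ℕ) (q : ℝ) : ρ j q ≤ j * w
  plateau_le (j : ℕ) (q : ℝ) : j * w ≤ ρ (j + 1) q
  turn_mem (j : ℕ) (q : ℝ) : ∀ v ∈ Set.Ioo (0 : ℝ) 1,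
    deriv (ρ j) q * (c j - v) ∈ Set.Icc 0 (1 - 2 * d)
  re_pos : ∀ z ∈ G, 0 < z.re
  im_pos : ∀ z ∈ G, 0 < z.im
  gate : ∀ z ∈ G, ∀ j : ℕ, z.im = j + 1 →
    (ρ j =ᶠ[𝓝 z.re] fun _ => j * w) ∧ ρ (j + 1) =ᶠ[𝓝 z.re] fun _ => j * w
  overlap : ∀ z ∈ G, ∀ z' ∈ G, z.re = z'.re → ∀ j : ℕ, ⌊z.im⌋₊ = j → ⌊z'.im⌋₊ = j + 1 →
    ρ (j + 1) z.re < (j + 1) * w →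
    (ρ j =ᶠ[𝓝 z.re] fun _ => j * w) ∧ j + 1 - d < z.im ∧ z'.im < j + 1 + d

/-- The shear of the staircase with profiles `ρ` and centres `c`. -/
noncomputable def staircaseLift (ρ : ℕ → ℝ → ℝ) (c : ℕ → ℝ) (z : Fin 2 → ℂ) : Fin 2 → ℂ :=
  hamiltonianShear (ρ ⌊(z 1).im⌋₊) (c ⌊(z 1).im⌋₊) z

namespace IsStaircase

variable {w d : ℝ} {ρ : ℕ → ℝ → ℝ} {c : ℕ → ℝ} {G : Set ℂ} {z z' : Fin 2 → ℂ}

theorem staircaseLift_eventuallyEq (S : IsStaircase w d ρ c G) (hz : z 1 ∈ G) :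
    staircaseLift ρ c =ᶠ[𝓝 z] hamiltonianShear (ρ ⌊(z 1).im⌋₊) (c ⌊(z 1).im⌋₊) := by
  have htop := Nat.lt_floor_add_one (z 1).im
  have hfloor := Nat.floor_le (S.im_pos _ hz).le
  generalize ⌊(z 1).im⌋₊ = j at htop hfloor ⊢
  have him : ContinuousAt (fun z : Fin 2 → ℂ => (z 1).im) z :=
    (Complex.continuous_im.comp (continuous_apply 1)).continuousAt
  have hre : ContinuousAt (fun z : Fin 2 → ℂ => (z 1).re) z :=
    (Complex.continuous_re.comp (continuous_apply 1)).continuousAt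
  have heq {j : ℕ} {z' : Fin 2 → ℂ} (hj : j ≤ (z' 1).im) (hj' : (z' 1).im < j + 1) :
      staircaseLift ρ c z' = hamiltonianShear (ρ j) (c j) z' := by
    rw [staircaseLift, (Nat.floor_eq_iff (j.cast_nonneg.trans hj)).2 ⟨hj, hj'⟩]
  rcases hfloor.lt_or_eq with hlt | heqj
  · filter_upwards [him.eventually_mem (Ioo_mem_nhds hlt htop)] with z' hz'
    exact heq hz'.1.le hz'.2
  obtain ⟨i, rfl⟩ : ∃ i, j = i + 1 := Nat.exists_eq_succ_of_ne_zero <| by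
    rintro rfl
    exact (S.im_pos _ hz).ne (by exact_mod_cast heqj)
  -- The profiles on the two sides of the gate `p = i + 1` agree where it is open.
  push_cast at heqj htop
  obtain ⟨hρi, hρj⟩ := S.gate _ hz i heqj.symm
  filter_upwards [him.eventually_mem (Ioo_mem_nhds (show (i : ℝ) < (z 1).im by linarith) htop),
    hre.eventually hρi.eventuallyEq_nhds, hre.eventually hρj.eventuallyEq_nhds]
    with z' hz' hi hj
  rcases lt_or_ge (z' 1).im (i + 1) with hlt | hle
  · rw [heq hz'.1.le hlt, hamiltonianShear_eq_of_eventuallyEq_const _ hi,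
      hamiltonianShear_eq_of_eventuallyEq_const _ hj]
  · exact heq (by exact_mod_cast hle) (by exact_mod_cast hz'.2)

theorem preservesFormAt_staircaseLift (S : IsStaircase w d ρ c G) (hz : z 1 ∈ G) :
    PreservesFormAt stdSymplecticForm (staircaseLift ρ c) z :=
  (preservesFormAt_hamiltonianShear _ (S.contDiff _) z).congr_of_eventuallyEq
    (S.staircaseLift_eventuallyEq hz)

theorem floor_eq_add_one_of_lt (S : IsStaircase w d ρ c G) (hw : 0 < w) {i j : ℕ} {q : ℝ}
    (hij : i < j) (hgap : ρ j q < ρ i q + w) : j = i + 1 := by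
  by_contra hne
  obtain ⟨m, rfl⟩ : ∃ m, j = m + 1 := Nat.exists_eq_succ_of_ne_zero (Nat.ne_zero_of_lt hij)
  have him : (i : ℝ) + 1 ≤ m := by exact_mod_cast show i + 1 ≤ m by omega
  have hmw := mul_le_mul_of_nonneg_right him hw.le
  linarith [S.le_plateau i q, S.plateau_le m q]

theorem floor_staircaseLift_not_lt (S : IsStaircase w d ρ c G)
    (hz₀ : z 0 ∈ fibredRegion 1 (fun _ => 0) fun _ => w) (hz₁ : z 1 ∈ G)
    (hz₀' : z' 0 ∈ fibredRegion 1 (fun _ => 0) fun _ => w) (hz₁' : z' 1 ∈ G)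
    (hre₀ : (staircaseLift ρ c z 0).re = (staircaseLift ρ c z' 0).re)
    (hre₁ : (z 1).re = (z' 1).re) {m : ℤ}
    (him₁ : (staircaseLift ρ c z 1).im = (staircaseLift ρ c z' 1).im + m) :
    ¬ ⌊(z 1).im⌋₊ < ⌊(z' 1).im⌋₊ := by
  intro hlt
  obtain ⟨i, hi⟩ : ∃ i, ⌊(z 1).im⌋₊ = i := ⟨_, rfl⟩
  obtain ⟨j, hj⟩ : ∃ j, ⌊(z' 1).im⌋₊ = j := ⟨_, rfl⟩
  have hfloor := Nat.floor_le (S.im_pos _ hz₁').le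
  have htop := Nat.lt_floor_add_one (z 1).im
  simp only [staircaseLift, hamiltonianShear, Matrix.cons_val_zero, Matrix.cons_val_one,
    ← hre₁, hi, hj] at hre₀ him₁ hlt hfloor htop
  obtain ⟨-, hu⟩ := hz₀
  obtain ⟨hv', hu'⟩ := hz₀'
  have hgap : ρ j (z 1).re < ρ i (z 1).re + w := by linarith [hu.2, hu'.1]
  obtain rfl := S.floor_eq_add_one_of_lt (hu.1.trans hu.2) hlt hgap
  have hclimb : ρ (i + 1) (z 1).re < (i + 1) * w := by linarith [S.le_plateau i (z 1).re]
  obtain ⟨hconst, him, him'⟩ := S.overlap _ hz₁ _ hz₁' hre₁ i hi hj hclimb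
  have hturn := S.turn_mem (i + 1) (z 1).re _ hv'
  rw [hconst.deriv_eq, deriv_const, zero_mul, sub_zero] at him₁
  push_cast at hfloor
  -- The angles differ by an amount strictly between `0` and `1`, hence not by an integer.
  have hm : (m : ℝ) < 0 := by linarith [hturn.1]
  have hm' : (-1 : ℝ) < m := by linarith [hturn.2]
  norm_cast at hm hm'
  omega

theorem eq_of_staircaseLift_eq_mod_int (S : IsStaircase w d ρ c G)
    (hz₀ : z 0 ∈ fibredRegion 1 (fun _ => 0) fun _ => w) (hz₁ : z 1 ∈ G)
    (hz₀' : z' 0 ∈ fibredRegion 1 (fun _ => 0) fun _ => w) (hz₁' : z' 1 ∈ G)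
    (hre : ∀ i, (staircaseLift ρ c z i).re = (staircaseLift ρ c z' i).re)
    (him : ∀ i, ∃ m : ℤ, (staircaseLift ρ c z i).im = (staircaseLift ρ c z' i).im + m) :
    z = z' := by
  obtain ⟨m₀, hm₀⟩ := him 0
  obtain ⟨m₁, hm₁⟩ := him 1
  have hq : (z 1).re = (z' 1).re := hre 1
  have hfloor : ⌊(z 1).im⌋₊ = ⌊(z' 1).im⌋₊ := le_antisymm
    (not_lt.1 (S.floor_staircaseLift_not_lt hz₀' hz₁' hz₀ hz₁ (hre 0).symm hq.symm (m := -m₁)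
      (by rw [hm₁]; push_cast; ring)))
    (not_lt.1 (S.floor_staircaseLift_not_lt hz₀ hz₁ hz₀' hz₁' (hre 0) hq hm₁))
  have hu := hre 0
  simp only [staircaseLift, hamiltonianShear, Matrix.cons_val_zero, Matrix.cons_val_one,
    hq, hfloor, add_left_inj] at hm₀ hm₁ hu
  have hv : (z 0).im = (z' 0).im := by
    refine eq_of_floor_eq_of_eq_add_int ?_ hm₀
    rw [Int.floor_eq_zero_iff.2 ⟨hz₀.1.1.le, hz₀.1.2⟩,
      Int.floor_eq_zero_iff.2 ⟨hz₀'.1.1.le, hz₀'.1.2⟩]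
  have hp : (z 1).im = (z' 1).im := by
    refine eq_of_floor_eq_of_eq_add_int (m := m₁) ?_ (by rw [hv] at hm₁; linarith)
    rw [← Int.natCast_floor_eq_floor (S.im_pos _ hz₁).le,
      ← Int.natCast_floor_eq_floor (S.im_pos _ hz₁').le, hfloor]
  exact funext (Fin.forall_fin_two.2 ⟨Complex.ext hu hv, Complex.ext hq hp⟩)

theorem isFormEmbedding_actionAngle_staircaseLift (S : IsStaircase w d ρ c G) {A : ℝ}
    (hA : ∀ z ∈ G, ρ ⌊z.im⌋₊ z.re + z.re ≤ A - w) :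
    IsFormEmbedding stdSymplecticForm (fun z i => actionAngle (staircaseLift ρ c z i))
      (Set.univ.pi ![fibredRegion 1 (fun _ => 0) fun _ => w, G]) (symplecticBall 2 A) := by
  have hdom {z : Fin 2 → ℂ} (hz : z ∈ Set.univ.pi ![fibredRegion 1 (fun _ => 0) fun _ => w, G]) :
      z 0 ∈ fibredRegion 1 (fun _ => 0) (fun _ => w) ∧ z 1 ∈ G := ⟨hz 0 trivial, hz 1 trivial⟩
  have hpos {z} (hz : z ∈ Set.univ.pi ![fibredRegion 1 (fun _ => 0) fun _ => w, G]) :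
      ∀ i, 0 < (staircaseLift ρ c z i).re := Fin.forall_fin_two.2
    ⟨add_pos_of_pos_of_nonneg (hdom hz).1.2.1 (S.nonneg _ _), S.re_pos (z 1) (hdom hz).2⟩
  refine ⟨fun z hz => ?_, fun z hz z' hz' h => ?_, fun z hz => ?_⟩
  · exact (PreservesFormAt.pi fun i => preservesFormAt_actionAngle (hpos hz i)).comp
      (S.preservesFormAt_staircaseLift (hdom hz).2)
  · have hmod (i : Fin 2) := re_eq_and_im_eq_add_int_of_actionAngle_eq (hpos hz i) (hpos hz' i)
      (congrFun h i)
    exact S.eq_of_staircaseLift_eq_mod_int (hdom hz).1 (hdom hz).2 (hdom hz').1 (hdom hz').2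
      (fun i => (hmod i).1) fun i => (hmod i).2
  · have hsum : (staircaseLift ρ c z 0).re + (staircaseLift ρ c z 1).re < A := by
      simp only [staircaseLift, hamiltonianShear, Matrix.cons_val_zero, Matrix.cons_val_one]
      linarith [hA _ (hdom hz).2, (hdom hz).1.2.2]
    change ∑ i, π * ‖actionAngle (staircaseLift ρ c z i)‖ ^ 2 / A < 1
    simp only [pi_mul_norm_actionAngle_sq (hpos hz _).le, Fin.sum_univ_two]
    rwa [← add_div, div_lt_one (by linarith [hpos hz 0, hpos hz 1])]

end IsStaircase

/-- The parameters of a `k`-fold wrapping into a ball of capacity `A`: the rectangle lifted has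
width `w`, each fold uses the length `L` in the action direction, `c` is the profile of a single
fold, and `d` is the tolerance that tends to `0` in the end. -/
structure FoldData where
  (A w d L : ℝ)
  k : ℕ
  c : ℝ → ℝ
  one_le_k : 1 ≤ k
  d_pos : 0 < d
  five_mul_d_lt : 5 * d < 1
  w_pos : 0 < w
  L_add_d_lt : L + d < A - w - (2 * k - 1) * L
  isSmoothStep : IsSmoothStep c d L w (1 - 2 * d)

namespace FoldData

variable (D : FoldData)

/-- The height of the `i`-th column, which fills `2 * i < p < 2 * i + 2`. -/
def top (i : ℕ) : ℝ := D.A - D.w - (2 * i + 1) * D.L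

/-- The bottom of the region over `(j, j + 1)`. The first and last half columns go all the way
down; the others leave room for a fold. -/
def bot (j : ℕ) : ℝ := if j = 0 ∨ j + 1 = 2 * D.k then 0 else D.L

/-- The profiles of the staircase: folds at the bottom and at the top of the columns alternate. -/
def rise : ℕ → ℝ → ℝ
  | 0 => fun _ => 0
  | j + 1 => fun q => j * D.w + if Even j then D.c (D.top (j / 2) + D.L - q) else D.c q

/-- The end of the interval `0 < v < 1` at which the shear with profile `rise j` does not move `p`,
chosen so that all shears move `p` upwards. -/
def center (j : ℕ) : ℝ := if Even j then 1 else 0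

theorem d_lt_L : D.d < D.L := by
  by_contra! h
  linarith [D.w_pos, D.isSmoothStep.eq_zero D.d le_rfl, D.isSmoothStep.eq_height D.d h]

theorem L_pos : 0 < D.L := D.d_pos.trans D.d_lt_L

theorem w_le_L : D.w ≤ D.L :=
  (D.isSmoothStep.eq_height D.L le_rfl).ge.trans
    (D.isSmoothStep.le_self (by linarith [D.d_pos]) D.d_pos.le D.L_pos.le)

theorem L_add_d_lt_top {i : ℕ} (hi : i < D.k) : D.L + D.d < D.top i := by
  have hik : (i : ℝ) + 1 ≤ D.k := by exact_mod_cast hi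
  have hmul := mul_le_mul_of_nonneg_right hik D.L_pos.le
  rw [top]
  linarith [D.L_add_d_lt]

theorem bot_le (j : ℕ) : D.bot j ≤ D.L := by
  rw [bot]
  split_ifs
  exacts [D.L_pos.le, le_rfl]

theorem bot_nonneg (j : ℕ) : 0 ≤ D.bot j := by
  rw [bot]
  split_ifs
  exacts [le_rfl, D.L_pos.le]

theorem rise_odd (i : ℕ) (q : ℝ) :
    D.rise (2 * i + 1) q = 2 * i * D.w + D.c (D.top i + D.L - q) := by
  simp [rise]

theorem rise_even (i : ℕ) (q : ℝ) : D.rise (2 * i + 2) q = (2 * i + 1) * D.w + D.c q := by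
  simp [rise]

theorem contDiff_rise : ∀ j, ContDiff ℝ ∞ (D.rise j)
  | 0 => contDiff_const
  | j + 1 => by
    refine contDiff_const.add ?_
    split_ifs
    exacts [D.isSmoothStep.contDiff.comp (contDiff_const.sub contDiff_id), D.isSmoothStep.contDiff]

theorem rise_le (j : ℕ) (q : ℝ) : D.rise j q ≤ j * D.w := by
  cases j with
  | zero => simp [rise]
  | succ j =>
    rw [rise]
    push_cast
    split_ifs
    · linarith [D.isSmoothStep.le_height (D.top (j / 2) + D.L - q)]
    · linarith [D.isSmoothStep.le_height q]

theorem le_rise (j : ℕ) (q : ℝ) : j * D.w ≤ D.rise (j + 1) q := by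
  rw [rise, le_add_iff_nonneg_right]
  split_ifs
  exacts [D.isSmoothStep.nonneg _, D.isSmoothStep.nonneg q]

theorem rise_nonneg (j : ℕ) (q : ℝ) : 0 ≤ D.rise j q := by
  cases j with
  | zero => exact le_rfl
  | succ j => exact (mul_nonneg j.cast_nonneg D.w_pos.le).trans (D.le_rise j q)

theorem deriv_rise_mul_mem (j : ℕ) (q : ℝ) {v : ℝ} (hv : v ∈ Set.Ioo (0 : ℝ) 1) :
    deriv (D.rise j) q * (center j - v) ∈ Set.Icc 0 (1 - 2 * D.d) := by
  have hmem {s t : ℝ} (ht : t ∈ Set.Ioo (0 : ℝ) 1) :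
      deriv D.c s * t ∈ Set.Icc 0 (1 - 2 * D.d) :=
    ⟨mul_nonneg (D.isSmoothStep.deriv_nonneg s) ht.1.le,
      (mul_le_of_le_one_right (D.isSmoothStep.deriv_nonneg s) ht.2.le).trans
        (D.isSmoothStep.deriv_le s)⟩
  have hv' : 1 - v ∈ Set.Ioo (0 : ℝ) 1 := ⟨by linarith [hv.2], by linarith [hv.1]⟩
  cases j with
  | zero =>
    have hd := D.five_mul_d_lt
    simp only [rise, deriv_const, zero_mul, Set.mem_Icc, le_refl, true_and]
    linarith [D.d_pos]
  | succ j =>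
    by_cases hj : Even j
    · simp only [rise, center, hj, Nat.even_add_one, not_true, if_true, if_false, deriv_const_add,
        deriv_comp_const_sub]
      rw [zero_sub, neg_mul_neg]
      exact hmem hv
    · simp only [rise, center, hj, Nat.even_add_one, not_false_iff, if_true, if_false,
        deriv_const_add]
      exact hmem hv'

section Plateaus

variable {D} {q : ℝ}

theorem rise_even_eventuallyEq_upper (i : ℕ) (hq : D.L < q) :
    D.rise (2 * i) =ᶠ[𝓝 q] fun _ => ((2 * i : ℕ) : ℝ) * D.w := by
  cases i with
  | zero => exact Filter.Eventually.of_forall fun _ => by simp [rise]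
  | succ i =>
    filter_upwards [eventually_gt_nhds hq] with s hs
    rw [mul_add_one, rise_even, D.isSmoothStep.eq_height s hs.le]
    push_cast
    ring

theorem rise_even_eventuallyEq_lower (i : ℕ) (hq : q < D.d) :
    D.rise (2 * i + 2) =ᶠ[𝓝 q] fun _ => ((2 * i + 1 : ℕ) : ℝ) * D.w := by
  filter_upwards [eventually_lt_nhds hq] with s hs
  rw [rise_even, D.isSmoothStep.eq_zero s hs.le]
  push_cast
  ring

theorem rise_odd_eventuallyEq_upper (i : ℕ) (hq : q < D.top i) :
    D.rise (2 * i + 1) =ᶠ[𝓝 q] fun _ => ((2 * i + 1 : ℕ) : ℝ) * D.w := by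
  filter_upwards [eventually_lt_nhds hq] with s hs
  rw [rise_odd, D.isSmoothStep.eq_height _ (by linarith)]
  push_cast
  ring

theorem rise_odd_eventuallyEq_lower (i : ℕ) (hq : D.top i + D.L - D.d < q) :
    D.rise (2 * i + 1) =ᶠ[𝓝 q] fun _ => ((2 * i : ℕ) : ℝ) * D.w := by
  filter_upwards [eventually_gt_nhds hq] with s hs
  rw [rise_odd, D.isSmoothStep.eq_zero _ (by linarith)]
  push_cast
  ring

end Plateaus

/-- The conditions on the fibre `l < q < u` at height `p` of the region over which the folds are
made. The column over `2 * i ≤ p ≤ 2 * i + 2` carries a spike of height `L` at `p = 2 * i + 1`,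
through whose tip it is passed; consecutive columns are joined at the bottom. -/
structure IsFibre (p l u : ℝ) : Prop where
  pos : 0 < l
  lt : l < u
  lt_tip : ∀ i < D.k, p ∈ Set.Icc (2 * i : ℝ) (2 * i + 2) → u < D.top i + D.L
  lt_top : ∀ i < D.k, p ∈ Set.Icc (2 * i : ℝ) (2 * i + 2) ∩ {p | D.d ≤ |p - (2 * i + 1)|} →
    u < D.top i
  L_lt : ∀ i < D.k, p ∈ Set.Icc (2 * i + D.d) (2 * i + 2 - D.d) ∩ Set.Icc 1 (2 * D.k - 1) → D.L < l
  gate_odd : ∀ i < D.k, p = 2 * i + 1 → D.top i + D.L - D.d < l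
  gate_even : ∀ i < D.k, p = 2 * i + 2 → i + 1 < D.k → u < D.d
  full : ∀ j < 2 * D.k, p ∈ Set.Icc (j + 2 * D.d) (j + 1 - 2 * D.d) →
    D.top (j / 2) - D.bot j - D.d < u - l

theorem convex_setOf_isFibre (p : ℝ) : Convex ℝ {x : ℝ × ℝ | D.IsFibre p x.1 x.2} := by
  intro x hx y hy a b ha hb hab
  have hsub : (a • x + b • y).2 - (a • x + b • y).1 = a • (x.2 - x.1) + b • (y.2 - y.1) := by
    simp only [Prod.fst_add, Prod.snd_add, Prod.smul_fst, Prod.smul_snd, smul_eq_mul]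
    ring
  have hlt {s s' t : ℝ} (hs : s < t) (hs' : s' < t) : a • s + b • s' < t :=
    convex_Iio (𝕜 := ℝ) t hs hs' ha hb hab
  have hgt {s s' t : ℝ} (hs : t < s) (hs' : t < s') : t < a • s + b • s' :=
    convex_Ioi (𝕜 := ℝ) t hs hs' ha hb hab
  exact
    { pos := hgt hx.pos hy.pos
      lt := by
        rw [← sub_pos, hsub]
        exact hgt (sub_pos.2 hx.lt) (sub_pos.2 hy.lt)
      lt_tip := fun i hi hp => hlt (hx.lt_tip i hi hp) (hy.lt_tip i hi hp)
      lt_top := fun i hi hp => hlt (hx.lt_top i hi hp) (hy.lt_top i hi hp)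
      L_lt := fun i hi hp => hgt (hx.L_lt i hi hp) (hy.L_lt i hi hp)
      gate_odd := fun i hi hp => hgt (hx.gate_odd i hi hp) (hy.gate_odd i hi hp)
      gate_even := fun i hi hp hik => hlt (hx.gate_even i hi hp hik) (hy.gate_even i hi hp hik)
      full := fun j hj hp => hsub ▸ hgt (hx.full j hj hp) (hy.full j hj hp) }

theorem isOpen_setOf_isFibre (l u : ℝ) : IsOpen {p | D.IsFibre p l u} := by
  refine isOpen_iff_mem_nhds.2 fun p hp => ?_
  have haway (i : ℕ) : IsClosed {p : ℝ | D.d ≤ |p - (2 * i + 1)|} :=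
    isClosed_le continuous_const (by fun_prop)
  have hodd (i : ℕ) : IsClosed {p : ℝ | p = 2 * i + 1} := isClosed_singleton
  have heven (i : ℕ) : IsClosed {p : ℝ | p = 2 * i + 2} := isClosed_singleton
  filter_upwards [
    (isOpen_setOf_forall_lt_imp (fun _ => isClosed_Icc) _ _).mem_nhds hp.lt_tip,
    (isOpen_setOf_forall_lt_imp (fun i => isClosed_Icc.inter (haway i)) _ _).mem_nhds hp.lt_top,
    (isOpen_setOf_forall_lt_imp (fun _ => isClosed_Icc.inter isClosed_Icc) _ _).mem_nhds hp.L_lt,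
    (isOpen_setOf_forall_lt_imp hodd _ _).mem_nhds hp.gate_odd,
    (isOpen_setOf_forall_lt_imp heven _ _).mem_nhds hp.gate_even,
    (isOpen_setOf_forall_lt_imp (fun _ => isClosed_Icc) _ _).mem_nhds hp.full]
    with p' htip htop hL hodd heven hfull
  exact ⟨hp.pos, hp.lt, htip, htop, hL, hodd, heven, hfull⟩

theorem natCast_notMem_Icc_window (n j : ℕ) :
    (n : ℝ) ∉ Set.Icc (j + 2 * D.d) (j + 1 - 2 * D.d) := by
  rintro ⟨hle, hge⟩
  have hjn : (j : ℝ) < n := by linarith [D.d_pos]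
  have hnj : (n : ℝ) < j + 1 := by linarith [D.d_pos]
  norm_cast at hjn hnj
  omega

theorem isFibre_odd {i : ℕ} (hi : i < D.k) :
    D.IsFibre (2 * i + 1 : ℕ) (D.top i + D.L - 2 / 3 * D.d) (D.top i + D.L - 1 / 3 * D.d) := by
  have hL := D.L_pos
  have hd := D.d_pos
  have htop := D.L_add_d_lt_top hi
  have heq {i' : ℕ} (h : ((2 * i + 1 : ℕ) : ℝ) ∈ Set.Icc (2 * i' : ℝ) (2 * i' + 2)) : i' = i := by
    obtain ⟨hle, hge⟩ := h
    norm_cast at hle hge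
    omega
  refine ⟨by linarith, by linarith, fun i' _ h => ?_, fun i' _ h => ?_, fun _ _ _ => by linarith,
    fun i' _ h => ?_, fun i' _ h => ?_, fun j _ h => absurd h (D.natCast_notMem_Icc_window _ j)⟩
  · rw [heq h]
    linarith
  · have habs : D.d ≤ |((2 * i + 1 : ℕ) : ℝ) - (2 * i' + 1)| := h.2
    rw [heq h.1] at habs
    push_cast at habs
    rw [sub_self, abs_zero] at habs
    linarith
  · norm_cast at h
    obtain rfl : i' = i := by omega
    linarith
  · norm_cast at h
    omega

theorem isFibre_even (i : ℕ) :
    D.IsFibre (2 * i + 2 : ℕ) (1 / 3 * D.d) (2 / 3 * D.d) := by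
  have hL := D.L_pos
  have hd := D.d_pos
  have htop {i' : ℕ} (hi' : i' < D.k) : 2 / 3 * D.d < D.top i' := by
    linarith [D.L_add_d_lt_top hi']
  refine ⟨by linarith, by linarith, fun i' hi' _ => by linarith [htop hi'],
    fun i' hi' _ => htop hi', fun i' _ h => ?_, fun i' _ h => ?_, fun _ _ _ _ => by linarith,
    fun j _ h => absurd h (D.natCast_notMem_Icc_window _ j)⟩
  · have hlt : (2 * i' : ℝ) < (2 * i + 2 : ℕ) := by linarith [h.1.1]
    have hgt : ((2 * i + 2 : ℕ) : ℝ) < 2 * i' + 2 := by linarith [h.1.2]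
    norm_cast at hlt hgt
    omega
  · norm_cast at h
    omega

theorem isFibre_window {p : ℝ} {j : ℕ} (hj : j < 2 * D.k)
    (hp : p ∈ Set.Icc (j + 2 * D.d) (j + 1 - 2 * D.d)) :
    D.IsFibre p (D.bot j + 1 / 3 * D.d) (D.top (j / 2) - 1 / 3 * D.d) := by
  have hL := D.L_pos
  have hd := D.d_pos
  have htop := D.L_add_d_lt_top (i := j / 2) (by omega)
  have hjp : (j : ℝ) < p := by linarith [hp.1]
  have hpj : p < j + 1 := by linarith [hp.2]
  have hne (n : ℕ) : p ≠ n := by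
    rintro rfl
    exact D.natCast_notMem_Icc_window n j hp
  have heq {i : ℕ} (h : p ∈ Set.Icc (2 * i : ℝ) (2 * i + 2)) : i = j / 2 := by
    have hlt : ((2 * i : ℕ) : ℝ) < (j + 1 : ℕ) := by push_cast; linarith [h.1]
    have hgt : (j : ℝ) < (2 * i + 2 : ℕ) := by push_cast; linarith [h.2]
    norm_cast at hlt hgt
    omega
  have heq' {j' : ℕ} (h : p ∈ Set.Icc (j' + 2 * D.d) (j' + 1 - 2 * D.d)) : j' = j := by
    have hlt : (j' : ℝ) < (j + 1 : ℕ) := by push_cast; linarith [h.1]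
    have hgt : (j : ℝ) < (j' + 1 : ℕ) := by push_cast; linarith [h.2]
    norm_cast at hlt hgt
    omega
  refine ⟨by linarith [D.bot_nonneg j], by linarith [D.bot_le j], fun i _ h => ?_,
    fun i _ h => ?_, fun i _ h => ?_, fun i _ h => absurd h (mod_cast hne (2 * i + 1)),
    fun i _ h => absurd h (mod_cast hne (2 * i + 2)), fun j' _ h => ?_⟩
  · rw [heq h]
    linarith
  · rw [heq h.1]
    linarith
  · have hbot : D.bot j = D.L := if_neg <| by
      rintro (rfl | hlast)
      · linarith [h.2.1, Nat.cast_zero (R := ℝ)]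
      · have : (j : ℝ) + 1 = 2 * D.k := by exact_mod_cast hlast
        linarith [h.2.2]
    linarith
  · rw [heq' h]
    linarith

theorem exists_isFibre (p : ℝ) : ∃ l u, D.IsFibre p l u := by
  by_cases hodd : ∃ i < D.k, p = (2 * i + 1 : ℕ)
  · obtain ⟨i, hi, rfl⟩ := hodd
    exact ⟨_, _, D.isFibre_odd hi⟩
  by_cases heven : ∃ i : ℕ, p = (2 * i + 2 : ℕ)
  · obtain ⟨i, rfl⟩ := heven
    exact ⟨_, _, D.isFibre_even i⟩
  by_cases hwindow : ∃ j < 2 * D.k, p ∈ Set.Icc (j + 2 * D.d) (j + 1 - 2 * D.d)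
  · obtain ⟨j, hj, hp⟩ := hwindow
    exact ⟨_, _, D.isFibre_window hj hp⟩
  have hd := D.d_pos
  have htop {i : ℕ} (hi : i < D.k) : D.L + 2 / 3 * D.d < D.top i := by
    linarith [D.L_add_d_lt_top hi]
  exact ⟨D.L + 1 / 3 * D.d, D.L + 2 / 3 * D.d,
    by linarith [D.L_pos], by linarith, fun i hi _ => by linarith [D.L_pos, htop hi],
    fun i hi _ => htop hi, fun _ _ _ => by linarith,
    fun i hi h => absurd ⟨i, hi, mod_cast h⟩ hodd,
    fun i _ h _ => absurd ⟨i, mod_cast h⟩ heven,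
    fun j hj h => absurd ⟨j, hj, h⟩ hwindow⟩

theorem exists_contDiff_isFibre :
    ∃ l u : ℝ → ℝ, ContDiff ℝ ∞ l ∧ ContDiff ℝ ∞ u ∧ ∀ p, D.IsFibre p (l p) (u p) := by
  obtain ⟨g, hg, hfibre⟩ := exists_contDiff_forall_mem_of_isOpen_of_convex
    (t := fun p => {x : ℝ × ℝ | D.IsFibre p x.1 x.2}) D.convex_setOf_isFibre
    (fun x => D.isOpen_setOf_isFibre x.1 x.2)
    fun p => (D.exists_isFibre p).elim fun l ⟨u, h⟩ => ⟨(l, u), h⟩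
  exact ⟨fun p => (g p).1, fun p => (g p).2, hg.fst, hg.snd, hfibre⟩

section Staircase

variable {D} {l u : ℝ → ℝ} {i : ℕ} {q : ℝ} {z z' : ℂ}

theorem top_lt_of_rise_odd_lt (h : D.rise (2 * i + 1) q < (2 * i + 1) * D.w) : D.top i < q := by
  by_contra! hq
  rw [rise_odd, D.isSmoothStep.eq_height _ (by linarith)] at h
  linarith

theorem lt_L_of_rise_even_lt (h : D.rise (2 * i + 2) q < (2 * i + 2) * D.w) : q < D.L := by
  by_contra! hq
  rw [rise_even, D.isSmoothStep.eq_height _ hq] at h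
  linarith

theorem rise_eventuallyEq_of_im_eq (hlu : ∀ p, D.IsFibre p (l p) (u p))
    (hz : z ∈ fibredRegion (2 * D.k : ℕ) l u) {j : ℕ} (hj : z.im = j + 1) :
    (D.rise j =ᶠ[𝓝 z.re] fun _ => j * D.w) ∧ D.rise (j + 1) =ᶠ[𝓝 z.re] fun _ => j * D.w := by
  have hd := D.d_pos
  have hL := D.d_lt_L
  have hjk : j + 1 < 2 * D.k := by exact_mod_cast hj ▸ hz.1.2
  obtain ⟨i, rfl | rfl⟩ := Nat.even_or_odd' j
  · have hi : i < D.k := by omega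
    have hq := ((hlu z.im).gate_odd i hi (by rw [hj]; push_cast; ring)).trans hz.2.1
    exact ⟨rise_even_eventuallyEq_upper i (by linarith [D.L_add_d_lt_top hi]),
      rise_odd_eventuallyEq_lower i hq⟩
  · have hi : i < D.k := by omega
    have hq := hz.2.2.trans <|
      (hlu z.im).gate_even i hi (by rw [hj]; push_cast; ring) (by omega)
    exact ⟨rise_odd_eventuallyEq_upper i (by linarith [D.L_add_d_lt_top hi]),
      rise_even_eventuallyEq_lower i hq⟩

theorem abs_im_sub_lt_of_top_lt (hlu : ∀ p, D.IsFibre p (l p) (u p))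
    (hz : z ∈ fibredRegion (2 * D.k : ℕ) l u) (hi : i < D.k)
    (hp : z.im ∈ Set.Icc (2 * i : ℝ) (2 * i + 2)) (hq : D.top i < z.re) :
    |z.im - (2 * i + 1)| < D.d := by
  by_contra! h
  exact (hz.2.2.trans ((hlu z.im).lt_top i hi ⟨hp, h⟩)).not_gt hq

theorem notMem_Icc_of_lt_L (hlu : ∀ p, D.IsFibre p (l p) (u p))
    (hz : z ∈ fibredRegion (2 * D.k : ℕ) l u) (hi : i < D.k)
    (hp : z.im ∈ Set.Icc (1 : ℝ) (2 * D.k - 1)) (hq : z.re < D.L) :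
    z.im ∉ Set.Icc (2 * i + D.d) (2 * i + 2 - D.d) := fun h =>
  (((hlu z.im).L_lt i hi ⟨h, hp⟩).trans hz.2.1).not_gt hq

theorem rise_eventuallyEq_and_im_near_of_rise_lt (hlu : ∀ p, D.IsFibre p (l p) (u p))
    (hz : z ∈ fibredRegion (2 * D.k : ℕ) l u) (hz' : z' ∈ fibredRegion (2 * D.k : ℕ) l u)
    (hre : z.re = z'.re) {j : ℕ} (hj : ⌊z.im⌋₊ = j) (hj' : ⌊z'.im⌋₊ = j + 1)
    (hclimb : D.rise (j + 1) z.re < (j + 1) * D.w) :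
    (D.rise j =ᶠ[𝓝 z.re] fun _ => j * D.w) ∧ j + 1 - D.d < z.im ∧ z'.im < j + 1 + D.d := by
  have hd := D.five_mul_d_lt
  have hd₀ := D.d_pos
  obtain ⟨hle, hlt⟩ := (Nat.floor_eq_iff hz.1.1.le).1 hj
  obtain ⟨hle', hlt'⟩ := (Nat.floor_eq_iff hz'.1.1.le).1 hj'
  have hjk : j + 1 < 2 * D.k := by exact_mod_cast hle'.trans_lt hz'.1.2
  obtain ⟨i, rfl | rfl⟩ := Nat.even_or_odd' j
  · push_cast at hle hlt hle' hlt' hclimb ⊢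
    have hi : i < D.k := by omega
    have hq := top_lt_of_rise_odd_lt hclimb
    have him := abs_lt.1 (abs_im_sub_lt_of_top_lt hlu hz hi ⟨hle, by linarith⟩ hq)
    have him' := abs_lt.1
      (abs_im_sub_lt_of_top_lt hlu hz' hi ⟨by linarith, by linarith⟩ (hre ▸ hq))
    exact ⟨by exact_mod_cast rise_even_eventuallyEq_upper i (by linarith [D.L_add_d_lt_top hi]),
      by linarith, by linarith⟩
  · push_cast at hle hlt hle' hlt' hclimb ⊢
    have hi : i + 1 < D.k := by omega
    have hik : (i : ℝ) + 2 ≤ D.k := by exact_mod_cast hi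
    have hq : z.re < D.L := lt_L_of_rise_even_lt (i := i) (by linarith)
    have him := notMem_Icc_of_lt_L hlu hz (i := i) (by omega) ⟨by linarith, by linarith⟩ hq
    have him' := notMem_Icc_of_lt_L hlu hz' hi ⟨by linarith, by linarith⟩ (hre ▸ hq)
    refine ⟨?_, ?_, ?_⟩
    · have htop := D.L_add_d_lt_top (i := i) (by omega)
      exact_mod_cast rise_odd_eventuallyEq_upper i (by linarith)
    · by_contra! h
      exact him ⟨by linarith, by linarith⟩
    · by_contra! h
      exact him' ⟨by push_cast; linarith, by push_cast; linarith⟩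

theorem isStaircase (hlu : ∀ p, D.IsFibre p (l p) (u p)) :
    IsStaircase D.w D.d D.rise center (fibredRegion (2 * D.k : ℕ) l u) where
  contDiff := D.contDiff_rise
  nonneg := D.rise_nonneg
  le_plateau := D.rise_le
  plateau_le := D.le_rise
  turn_mem j q _ := D.deriv_rise_mul_mem j q
  re_pos z hz := (hlu z.im).pos.trans hz.2.1
  im_pos _ hz := hz.1.1
  gate _ hz _ := rise_eventuallyEq_of_im_eq hlu hz
  overlap _ hz _ hz' hre _ := rise_eventuallyEq_and_im_near_of_rise_lt hlu hz hz' hre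

theorem rise_add_re_le (hlu : ∀ p, D.IsFibre p (l p) (u p))
    (hz : z ∈ fibredRegion (2 * D.k : ℕ) l u) : D.rise ⌊z.im⌋₊ z.re + z.re ≤ D.A - D.w := by
  obtain ⟨j, hj⟩ : ∃ j, ⌊z.im⌋₊ = j := ⟨_, rfl⟩
  obtain ⟨hle, hlt⟩ := (Nat.floor_eq_iff hz.1.1.le).1 hj
  have hjk : j < 2 * D.k := by exact_mod_cast hle.trans_lt hz.1.2
  obtain ⟨i, rfl | rfl⟩ := Nat.even_or_odd' j <;> rw [hj] <;> push_cast at hle hlt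
  all_goals
    have hiw := mul_le_mul_of_nonneg_left D.w_le_L (i.cast_nonneg (α := ℝ))
    have htip := hz.2.2.trans
      ((hlu z.im).lt_tip i (by omega) ⟨by linarith, by linarith⟩)
    rw [top] at htip
  · have hrise := D.rise_le (2 * i) z.re
    push_cast at hrise
    linarith
  · have hc := D.isSmoothStep.le_self (by linarith [D.d_pos]) D.d_pos.le
      (s := D.top i + D.L - z.re) (by rw [top]; linarith)
    rw [rise_odd]
    rw [top] at hc ⊢
    linarith

end Staircase

theorem sum_top (n : ℕ) :
    ∑ j ∈ Finset.range (2 * n), D.top (j / 2) = 2 * n * (D.A - D.w) - 2 * n ^ 2 * D.L := by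
  induction n with
  | zero => simp
  | succ n ih =>
    have hdiv : (2 * n + 1) / 2 = n := by omega
    rw [mul_add_one, Finset.sum_range_succ, Finset.sum_range_succ, ih, hdiv,
      Nat.mul_div_cancel_left n two_pos, top]
    push_cast
    ring

theorem sum_bot : ∑ j ∈ Finset.range (2 * D.k), D.bot j = (2 * D.k - 2) * D.L := by
  obtain ⟨m, hm⟩ := Nat.exists_eq_add_of_le' D.one_le_k
  have hmid : ∀ j ∈ Finset.range (2 * m), D.bot (j + 1) = D.L := fun j hj => if_neg <| by
    have := Finset.mem_range.1 hj
    omega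
  have hfirst : D.bot 0 = 0 := if_pos (Or.inl rfl)
  have hlast : D.bot (2 * m + 1) = 0 := if_pos (Or.inr (by omega))
  rw [hm, mul_add_one, Finset.sum_range_succ, Finset.sum_range_succ', hfirst, hlast,
    Finset.sum_congr rfl hmid, Finset.sum_const, Finset.card_range, nsmul_eq_mul]
  push_cast
  ring

theorem le_integral_of_isFibre {l u : ℝ → ℝ} (hl : Continuous l) (hu : Continuous u)
    (hlu : ∀ p, D.IsFibre p (l p) (u p)) :
    (1 - 4 * D.d) * (2 * D.k * (D.A - D.w) - 2 * D.k ^ 2 * D.L - (2 * D.k - 2) * D.L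
      - 2 * D.k * D.d) ≤ ∫ p in (0 : ℝ)..(2 * D.k : ℕ), (u p - l p) := by
  have hd := D.d_pos
  have hd' := D.five_mul_d_lt
  convert mul_sum_le_integral_of_forall_window (f := fun p => u p - l p) (hu.sub hl)
    (fun p => (sub_pos.2 (hlu p).lt).le) (δ := 2 * D.d) (by linarith) (by linarith)
    (fun j hj p hp => ((hlu p).full j hj hp).le) using 1
  rw [Finset.sum_sub_distrib, Finset.sum_sub_distrib, D.sum_top, D.sum_bot, Finset.sum_const,
    Finset.card_range, nsmul_eq_mul]
  push_cast
  ring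

theorem symplecticallyEmbeds {a b : ℝ} (ha : 0 < a) (hb : 0 < b) (hbw : b ≤ D.w)
    (harea : a ≤ (1 - 4 * D.d) * (2 * D.k * (D.A - D.w) - 2 * D.k ^ 2 * D.L
      - (2 * D.k - 2) * D.L - 2 * D.k * D.d)) :
    SymplecticallyEmbeds (polydisc ![b, a]) (symplecticBall 2 D.A) := by
  obtain ⟨l, u, hl, hu, hlu⟩ := D.exists_contDiff_isFibre
  obtain ⟨g₀, hg₀⟩ := exists_isFormEmbedding_openDisc_fibredRegion (l := fun _ => 0)
    (u := fun _ => D.w) contDiff_const contDiff_const (fun _ => D.w_pos) zero_le_one hb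
    (by simpa using hbw)
  obtain ⟨g₁, hg₁⟩ := exists_isFormEmbedding_openDisc_fibredRegion hl hu (fun p => (hlu p).lt)
    (Nat.cast_nonneg (2 * D.k)) ha
    (harea.trans (D.le_integral_of_isFibre hl.continuous hu.continuous hlu))
  have hg : IsFormEmbedding stdSymplecticForm (fun z i => ![g₀, g₁] i (z i))
      (Set.univ.pi fun i => openDisc (![b, a] i))
      (Set.univ.pi ![fibredRegion 1 (fun _ => 0) fun _ => D.w,
        fibredRegion (2 * D.k : ℕ) l u]) :=
    IsFormEmbedding.pi (Fin.forall_fin_two.2 ⟨hg₀, hg₁⟩)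
  have hlift := ((isStaircase hlu).isFormEmbedding_actionAngle_staircaseLift
    fun _ => rise_add_re_le hlu).comp hg
  rw [← polydisc_eq_univ_pi] at hlift
  exact ⟨_, hlift.isSymplecticEmbedding (isOpen_polydisc _)⟩

end FoldData

theorem symplecticallyEmbeds_polydisc_ball {a b A : ℝ} {k : ℕ} (ha : 0 < a) (hb : 0 < b)
    (hk : 1 ≤ k) (hA : (2 * k + 1) * b < A) (harea : (a - 2 * b) / (2 * k) + (k + 2) * b < A) :
    SymplecticallyEmbeds (polydisc ![b, a]) (symplecticBall 2 A) := by
  let L : ℝ → ℝ := fun d => d + (b + 2 * d) / (1 - 2 * d)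
  have hL : ContinuousAt L 0 :=
    continuousAt_id.add (ContinuousAt.div (by fun_prop) (by fun_prop) (by norm_num))
  have hL₀ : L 0 = b := by simp [L]
  have hroom : ∀ᶠ d in 𝓝 0, L d + d < A - b - (2 * k - 1) * L d := by
    refine ContinuousAt.eventually_lt (by fun_prop) (by fun_prop) ?_
    rw [hL₀]
    linarith
  have hfit : ∀ᶠ d in 𝓝 0, a < (1 - 4 * d) * (2 * k * (A - b) - 2 * (k : ℝ) ^ 2 * L d
      - (2 * k - 2) * L d - 2 * k * d) := by
    refine ContinuousAt.eventually_lt continuousAt_const (by fun_prop) ?_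
    rw [← lt_sub_iff_add_lt, div_lt_iff₀ (by positivity)] at harea
    rw [hL₀]
    linarith
  have hsmall : ∀ᶠ d : ℝ in 𝓝 0, d < 1 / 5 := eventually_lt_nhds (by norm_num)
  obtain ⟨d, ⟨hroom, hfit, hsmall⟩, hd⟩ := (((hroom.and (hfit.and hsmall)).filter_mono
    nhdsWithin_le_nhds).and (eventually_mem_nhdsWithin (a := (0 : ℝ)) (s := Set.Ioi 0))).exists
  have hd : 0 < d := hd
  have hμ : 0 < 1 - 2 * d := by linarith
  obtain ⟨c, hc⟩ := exists_isSmoothStep (d := d) (L := L d) hb hμ <| by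
    rw [add_sub_cancel_left, mul_div_cancel₀ _ hμ.ne']
    linarith
  exact (FoldData.mk A b d (L d) k c hk hd (by linarith) hb hroom hc).symplecticallyEmbeds
    ha hb le_rfl hfit.le

theorem mainTheorem9 (a ε : ℝ) (ha : 2 * π < a) (hε : 0 < ε) :
    SymplecticallyEmbeds (polydisc ![π, a]) (symplecticBall 2 (sPB a + ε)) := by
  obtain ⟨k, hk, -⟩ := existsUnique_isFoldIndex ha
  rw [sPB_eq ha hk]
  obtain ⟨hk₁, hlow, -⟩ := hk
  have hfolds : ((k : ℝ) - 1) * π < (a - 2 * π) / (2 * k) := by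
    rw [lt_div_iff₀ Real.pi_pos] at hlow
    rw [lt_div_iff₀ (by positivity)]
    linarith
  exact symplecticallyEmbeds_polydisc_ball (Real.two_pi_pos.trans ha) Real.pi_pos hk₁
    (by linarith) (by linarith)
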